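/- Let $n\geqslant 3$ be an integer and let $\alpha=e^{2\pi i/2^n}$. For an integer $j$ put $d_j=1+\alpha^j+\alpha^{-j}$; this number is nonzero. Let $D=\langle d_1,d_3,\dots,d_{2^{n-1}-3}\rangle$ be the subgroup of the multiplicative group $\mathbb{C}^*$ generated by the $2^{n-2}-1$ numbers $d_{2l+1}$, $0\leqslant l\leqslant 2^{n-2}-2$, let $D^{2^{n-2}}=\{u^{2^{n-2}} : u\in D\}$, and let $E=D\cap(1+2\mathbb{Z}[\alpha])$. 1. The index of the subgroup $D^{2^{n-2}}$ in $D$, equivalently the order of the quotient group $D/D^{2^{n-2}}$, is $$\left|D:D^{2^{n-2}}\right|=(2^{n-2})^{2^{n-2}-1}=2^{(n-2)(2^{n-2}-1)}.$$ 2. The set $E$ is a proper subgroup of $D$ containing $D^{2^{n-2}}$, that is, $D^{2^{n-2}}\leqslant E<D$. -/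

import Mathlib

noncomputable section

namespace CircularUnits

/-- The primitive `2 ^ n`-th root of unity `α = exp (2πi / 2 ^ n)`. -/
def alpha (n : ℕ) : ℂ := Complex.exp (2 * Real.pi * Complex.I / (2 ^ n : ℂ))

/-- The ring `ℤ[α]` of polynomials in `α` with integer coefficients. -/
def intRing (n : ℕ) : Subalgebra ℤ ℂ := Algebra.adjoin ℤ {alpha n}

/-- The number `d_j = 1 + α ^ j + α ^ (-j)`, for an integer `j`. -/
def d (n : ℕ) (j : ℤ) : ℂ := 1 + alpha n ^ j + alpha n ^ (-j)

theorem alpha_ne_zero (n : ℕ) : alpha n ≠ 0 := Complex.exp_ne_zero _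

theorem alpha_pow (n : ℕ) : alpha n ^ (2 ^ n) = 1 := by
  have h : ((2 ^ n : ℕ) : ℂ) * (2 * Real.pi * Complex.I / (2 ^ n : ℂ)) =
      2 * Real.pi * Complex.I := by
    push_cast
    field_simp
  rw [alpha, ← Complex.exp_nat_mul, h, Complex.exp_two_pi_mul_I]

theorem d_ne_zero (n : ℕ) (j : ℤ) : d n j ≠ 0 := by
  intro h
  have hb : alpha n ^ j ≠ 0 := zpow_ne_zero _ (alpha_ne_zero n)
  have hp : (alpha n ^ j) ^ (2 ^ n) = 1 := by
    rw [← zpow_natCast, zpow_comm, zpow_natCast, alpha_pow, one_zpow]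
  rw [d, zpow_neg] at h
  generalize alpha n ^ j = b at h hb hp
  have h2 : b ^ 2 + b + 1 = 0 := by
    field_simp at h
    linear_combination h
  have h3 : b ^ 3 = 1 := by linear_combination (b - 1) * h2
  have h1 : b = 1 := by
    have hc : Nat.Coprime (2 ^ n) 3 := Nat.Coprime.pow_left n (by norm_num)
    have := pow_gcd_eq_one.mpr ⟨hp, h3⟩
    rwa [hc.gcd_eq_one, pow_one] at this
  rw [h1] at h2
  norm_num at h2

/-- `d_j` as an element of the multiplicative group `ℂˣ`. -/
def dUnit (n : ℕ) (j : ℤ) : ℂˣ := Units.mk0 (d n j) (d_ne_zero n j)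

/-- The group `D` generated by `d_1, d_3, …, d_{2 ^ (n - 1) - 3}`. -/
def D (n : ℕ) : Subgroup ℂˣ :=
  Subgroup.closure {u | ∃ l : ℕ, l < 2 ^ (n - 2) - 1 ∧ u = dUnit n (2 * (l : ℤ) + 1)}

/-- The group `D ^ (2 ^ (n - 2))` of all `2 ^ (n - 2)`-th powers of elements of `D`. -/
def DPow (n : ℕ) : Subgroup ℂˣ := (D n).map (powMonoidHom (2 ^ (n - 2)))

/-- The set `E = D ∩ (1 + 2ℤ[α])`. -/
def E (n : ℕ) : Set ℂˣ := {u | u ∈ D n ∧ ∃ ρ ∈ intRing n, (u : ℂ) = 1 + 2 * ρ}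

end CircularUnits

end

/-! The index is `N ^ r` for `N = 2 ^ (n - 2)` once `D` is free of rank `r = N - 1`, so the core is
`linearIndependent_dUnit`. Let σ be the automorphism α ↦ α⁵. Odd residues are ± powers of 5 and d_j
= d_{-j}, so each generator is a σ-conjugate of d_1. A multiplicative relation becomes f(σ) d_1 = 1
with f in ℤ[X], deg f < N, and one coefficient zero because one conjugate is omitted. If 1 + X^(2^i)
did not divide f, some integer c ≠ 0 would be a combination of the two, and σ^(2^i) would fix a
nonzero power of d_{2^s}, s + i = n - 3, which fails on absolute values (`one_add_X_two_pow_dvd`).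
Hence 1 + X + ... + X^(N-1) divides f, and the zero coefficient forces f = 0.

For `E`: squaring is additive modulo 2, so d_j^N ≡ 1 + y + y⁻¹ with y² = -1, which is 1. Were d_1 in
`E`, a cyclotomic polynomial of degree at least 4 would divide X² + 1 modulo 2. -/

open Polynomial

noncomputable section

/-! ### Divisibility by the polynomials 1 + X^(2^i). -/

namespace Polynomial

theorem cyclotomic_two_pow_succ (i : ℕ) (R : Type*) [CommRing R] :
    cyclotomic (2 ^ (i + 1)) R = 1 + X ^ 2 ^ i := by
  simp [cyclotomic_prime_pow_eq_geom_sum Nat.prime_two, Finset.sum_range_succ]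

theorem prod_one_add_X_two_pow_mul (m : ℕ) (R : Type*) [CommRing R] :
    (∏ i ∈ Finset.range m, (1 + X ^ 2 ^ i : R[X])) * (X - 1) = X ^ 2 ^ m - 1 := by
  induction m with
  | zero => simp
  | succ m ih =>
    rw [Finset.prod_range_succ, mul_right_comm, ih, pow_succ 2 m, pow_mul]
    ring

theorem prod_one_add_X_two_pow (m : ℕ) (R : Type*) [CommRing R] [IsDomain R] :
    ∏ i ∈ Finset.range m, (1 + X ^ 2 ^ i : R[X]) = ∑ i ∈ Finset.range (2 ^ m), X ^ i := by
  have h : (X - 1 : R[X]) ≠ 0 := by simpa using X_sub_C_ne_zero (1 : R)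
  apply mul_right_cancel₀ h
  rw [prod_one_add_X_two_pow_mul, geom_sum_mul]

/-- A rational polynomial of degree less than `2 ^ m` with a vanishing coefficient below `2 ^ m`
vanishes as soon as it is divisible by all `1 + X ^ (2 ^ i)` with `i < m`. -/
theorem eq_zero_of_forall_one_add_X_two_pow_dvd {m k : ℕ} {f : ℚ[X]}
    (hdeg : f.degree < (2 ^ m : ℕ)) (hk : k < 2 ^ m) (hfk : f.coeff k = 0)
    (h : ∀ i < m, (1 + X ^ 2 ^ i : ℚ[X]) ∣ f) : f = 0 := by
  have hd : ∏ i ∈ Finset.range m, (1 + X ^ 2 ^ i : ℚ[X]) ∣ f := by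
    apply Finset.prod_dvd_of_coprime
    · intro i _ j _ hij
      rw [Function.onFun, ← cyclotomic_two_pow_succ, ← cyclotomic_two_pow_succ]
      apply cyclotomic.isCoprime_rat
      intro h
      have := Nat.pow_right_injective le_rfl h
      omega
    · intro i hi
      exact h i (Finset.mem_range.mp hi)
  rw [prod_one_add_X_two_pow] at hd
  obtain ⟨q, rfl⟩ := hd
  by_cases hq : q = 0
  · simp [hq]
  have hM : 0 < 2 ^ m := by positivity
  have hXM : (X ^ 2 ^ m - C 1 : ℚ[X]).degree = (2 ^ m : ℕ) := degree_X_pow_sub_C hM 1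
  -- Multiplying by X - 1 telescopes the geometric sum; comparing degrees then makes `q` constant.
  have hle : ((∑ i ∈ Finset.range (2 ^ m), X ^ i) * q * (X - C 1)).degree ≤
      ((2 ^ m : ℕ) : WithBot ℕ) := by
    rw [degree_mul, degree_X_sub_C]
    exact Nat.WithBot.add_one_le_of_lt hdeg
  rw [mul_right_comm, C_1, geom_sum_mul, ← C_1, degree_mul, hXM, degree_eq_natDegree hq] at hle
  have hq0 : q.natDegree = 0 := by
    norm_cast at hle
    omega
  rw [eq_C_of_natDegree_eq_zero hq0] at hfk ⊢
  rw [coeff_mul_C, finsetSum_coeff] at hfk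
  simp only [coeff_X_pow, Finset.sum_ite_eq, Finset.mem_range, hk, if_true, one_mul] at hfk
  rw [hfk, C_0, mul_zero]

theorem exists_C_mul_eq_map (p : ℚ[X]) :
    ∃ c : ℤ, c ≠ 0 ∧ ∃ q : ℤ[X], C (c : ℚ) * p = q.map (Int.castRingHom ℚ) := by
  obtain ⟨b, hb0, hb⟩ := IsLocalization.integerNormalization_spec (nonZeroDivisors ℤ) p
  refine ⟨b, nonZeroDivisors.ne_zero hb0, IsLocalization.integerNormalization (nonZeroDivisors ℤ) p, ?_⟩
  rw [show Int.castRingHom ℚ = algebraMap ℤ ℚ from rfl, hb]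
  ext i
  simp

/-- If an irreducible rational polynomial with integer coefficients does not divide `f`, then
some nonzero integer is an integral combination of the two polynomials. -/
theorem exists_int_combination_eq_C {p f : ℤ[X]} (hp : Irreducible (p.map (Int.castRingHom ℚ)))
    (h : ¬ p.map (Int.castRingHom ℚ) ∣ f.map (Int.castRingHom ℚ)) :
    ∃ c : ℤ, c ≠ 0 ∧ ∃ u v : ℤ[X], u * f + v * p = C c := by
  obtain ⟨a, b, hab⟩ := (hp.coprime_iff_not_dvd).mpr h
  obtain ⟨c, hc, u, hu⟩ := exists_C_mul_eq_map a
  obtain ⟨e, he, v, hv⟩ := exists_C_mul_eq_map b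
  refine ⟨c * e, mul_ne_zero hc he, C c * v, C e * u, ?_⟩
  apply map_injective (Int.castRingHom ℚ) Int.cast_injective
  simp only [Polynomial.map_add, Polynomial.map_mul, ← hu, ← hv, C_mul, map_C,
    Int.coe_castRingHom]
  linear_combination (C (c : ℚ) * C (e : ℚ)) * hab

end Polynomial

/-! ### Powers of 5 modulo powers of 2. -/

namespace CircularUnits

theorem five_pow_two_pow (i : ℕ) : ∃ c, Odd c ∧ 5 ^ 2 ^ i = 1 + 2 ^ (i + 2) * c := by
  induction i with
  | zero => exact ⟨1, odd_one, by norm_num⟩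
  | succ i ih =>
    obtain ⟨c, hc, h⟩ := ih
    refine ⟨c + 2 ^ (i + 1) * c ^ 2, ?_, ?_⟩
    · exact hc.add_even (by simp [pow_succ])
    · rw [pow_succ 2 i, pow_mul, h]; ring

theorem five_pow_inj {n i j : ℕ} (hi : i < 2 ^ n) (hj : j < 2 ^ n)
    (h : (5 : ZMod (2 ^ (n + 2))) ^ i = 5 ^ j) : i = j := by
  have := ZMod.orderOf_five n
  exact pow_injOn_Iio_orderOf (by simpa [this]) (by simpa [this]) h

theorem five_pow_ne_neg {n i j : ℕ} : (5 : ZMod (2 ^ (n + 2))) ^ i ≠ -5 ^ j := by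
  intro h
  have h4 := congrArg (ZMod.castHom (pow_dvd_pow 2 (by omega : 2 ≤ n + 2)) (ZMod (2 ^ 2))) h
  simp only [map_pow, map_neg, map_ofNat] at h4
  rw [show (5 : ZMod (2 ^ 2)) = 1 by decide, one_pow, one_pow] at h4
  exact absurd h4 (by decide)

/-- Up to sign, every odd residue modulo a power of `2` is a power of `5`. -/
theorem exists_five_pow_index (n : ℕ) : ∃ e : ℕ → ℕ, (∀ l : ℕ, l < 2 ^ n → e l < 2 ^ n) ∧
    Set.InjOn e (Set.Iio (2 ^ n) : Set ℕ) ∧ ∀ l : ℕ, l < 2 ^ n →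
      ((2 * (l : ℕ) + 1 : ZMod (2 ^ (n + 2))) = 5 ^ e l ∨
        (2 * (l : ℕ) + 1 : ZMod (2 ^ (n + 2))) = -5 ^ e l) := by
  have key : ∀ i : Fin (2 ^ n), ∃ l : Fin (2 ^ n),
      (2 * (l : ℕ) + 1 : ZMod (2 ^ (n + 2))) = 5 ^ (i : ℕ) ∨
      (2 * (l : ℕ) + 1 : ZMod (2 ^ (n + 2))) = -5 ^ (i : ℕ) := by
    intro i
    set r := 5 ^ (i : ℕ) % 2 ^ (n + 2) with hr
    have hlt : r < 2 ^ (n + 2) := Nat.mod_lt _ (by positivity)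
    have hcast : (r : ZMod (2 ^ (n + 2))) = 5 ^ (i : ℕ) := by simp [hr]
    have hodd : r % 2 = 1 := by
      rw [hr, Nat.mod_mod_of_dvd _ (dvd_pow_self 2 (by omega))]
      exact Nat.odd_iff.mp (Odd.pow (by decide))
    have h0 : ((2 ^ (n + 2) : ℕ) : ZMod (2 ^ (n + 2))) = 0 := ZMod.natCast_self _
    have h4 : 2 ^ (n + 2) = 4 * 2 ^ n := by ring
    -- One of the odd numbers `r` and `2 ^ (n + 2) - r` lies below half the modulus, hence is 2l + 1
    -- with l < 2^n.
    by_cases h : r < 2 * 2 ^ n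
    · refine ⟨⟨r / 2, by omega⟩, Or.inl ?_⟩
      rw [← hcast]
      exact_mod_cast congrArg (Nat.cast (R := ZMod (2 ^ (n + 2)))) (by omega : 2 * (r / 2) + 1 = r)
    · refine ⟨⟨(2 ^ (n + 2) - r) / 2, by omega⟩, Or.inr ?_⟩
      rw [← hcast, eq_neg_iff_add_eq_zero, ← h0]
      exact_mod_cast congrArg (Nat.cast (R := ZMod (2 ^ (n + 2))))
        (by omega : 2 * ((2 ^ (n + 2) - r) / 2) + 1 + r = 2 ^ (n + 2))
  choose ψ hψ using key
  have hinj : Function.Injective ψ := by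
    intro i j hij
    have hi := hψ i
    have hj := hψ j
    rw [hij] at hi
    apply Fin.ext
    apply five_pow_inj i.2 j.2
    rcases hi with hi | hi <;> rcases hj with hj | hj <;> rw [hi] at hj
    · exact hj
    · exact absurd hj five_pow_ne_neg
    · exact absurd hj.symm five_pow_ne_neg
    · exact neg_injective hj
  let eqv := Equiv.ofBijective ψ (Finite.injective_iff_bijective.mp hinj)
  refine ⟨fun l => if h : l < 2 ^ n then eqv.symm ⟨l, h⟩ else 0, ?_, ?_, ?_⟩
  · intro l hl
    simp [hl]
  · intro l hl l' hl' h
    simp only [Set.mem_Iio] at hl hl'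
    simp only [hl, hl', dite_true] at h
    simpa using eqv.symm.injective (Fin.ext h)
  · intro l hl
    have := hψ (eqv.symm ⟨l, hl⟩)
    rw [show ψ (eqv.symm ⟨l, hl⟩) = ⟨l, hl⟩ from eqv.apply_symm_apply _] at this
    simpa [hl] using this

end CircularUnits

/-! ### The Galois action on the numbers d_k. -/

namespace CircularUnits

theorem isPrimitiveRoot_alpha (n : ℕ) : IsPrimitiveRoot (alpha n) (2 ^ n) := by
  have := Complex.isPrimitiveRoot_exp (2 ^ n) (by positivity)
  simpa [alpha] using this

theorem conj_alpha_pow (n k : ℕ) : (starRingEnd ℂ) (alpha n ^ k) = (alpha n ^ k)⁻¹ := by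
  rw [Complex.inv_def, Complex.normSq_eq_norm_sq, norm_pow,
    (isPrimitiveRoot_alpha n).norm'_eq_one (by positivity)]
  simp

theorem exists_real_eq_d (n k : ℕ) : ∃ r : ℝ, (r : ℂ) = d n k := by
  obtain ⟨r, hr⟩ := Complex.conj_eq_iff_real.mp (show (starRingEnd ℂ) (d n k) = d n k by
    rw [d, zpow_neg, zpow_natCast, map_add, map_add, map_inv₀, conj_alpha_pow, inv_inv, map_one]
    ring)
  exact ⟨r, hr.symm⟩

theorem alpha_pow_two_pow_pred {n : ℕ} : alpha (n + 1) ^ 2 ^ n = -1 := by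
  have h : (alpha (n + 1) ^ 2 ^ n) ^ 2 = 1 := by rw [← pow_mul, ← pow_succ, alpha_pow]
  refine (eq_or_eq_neg_of_sq_eq_sq _ 1 (by simpa using h)).resolve_left fun h1 => ?_
  have := (Nat.pow_dvd_pow_iff_le_right (by norm_num)).mp
    ((isPrimitiveRoot_alpha (n + 1)).dvd_of_pow_eq_one _ h1)
  omega

/-- A field with an embedding into `ℂ` whose image contains `α`, and a lift to it of the Galois
automorphism `α ↦ α ^ 5`. -/
structure GaloisModel (n : ℕ) where
  K : Type
  [field : Field K]
  ι : K →+* ℂ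
  σ : K →+* K
  ζ : K
  ι_ζ : ι ζ = alpha n
  σ_ζ : σ ζ = ζ ^ 5

attribute [instance] GaloisModel.field

theorem nonempty_galoisModel (n : ℕ) : Nonempty (GaloisModel n) := by
  have : NeZero (2 ^ n) := ⟨by positivity⟩
  let K := CyclotomicField (2 ^ n) ℚ
  have : IsCyclotomicExtension {2 ^ n} ℚ K := CyclotomicField.isCyclotomicExtension (2 ^ n) ℚ
  let ι : K →ₐ[ℚ] ℂ := IsAlgClosed.lift
  have hz := IsCyclotomicExtension.zeta_spec (2 ^ n) ℚ K
  have hιz := hz.map_of_injective (f := ι) ι.injective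
  obtain ⟨i, -, hi⟩ := hιz.eq_pow_of_pow_eq_one (alpha_pow n)
  have h5 : Nat.Coprime 5 (2 ^ n) := Nat.Coprime.pow_right n (by norm_num)
  let σ : K ≃ₐ[ℚ] K := (IsCyclotomicExtension.Rat.galEquivZMod (2 ^ n) K).symm
    (ZMod.unitOfCoprime 5 h5)
  refine ⟨{
    K := K
    ι := ι
    σ := σ
    ζ := IsCyclotomicExtension.zeta (2 ^ n) ℚ K ^ i
    ι_ζ := ?_
    σ_ζ := ?_ }⟩
  · simpa using hi
  · have hp : (IsCyclotomicExtension.zeta (2 ^ n) ℚ K ^ i) ^ 2 ^ n = 1 := by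
      rw [pow_right_comm, hz.pow_eq_one, one_pow]
    have := IsCyclotomicExtension.Rat.galEquivZMod_apply_of_pow_eq (2 ^ n) K σ hp
    simp only [σ, MulEquiv.apply_symm_apply, ZMod.coe_unitOfCoprime] at this
    refine this.trans (pow_eq_pow_of_modEq ?_ hp)
    rw [ZMod.val_natCast]
    exact Nat.mod_modEq _ _

namespace GaloisModel

variable {n : ℕ} (S : GaloisModel n)

theorem ζ_pow_eq_of_cast_eq {k l : ℕ} (h : (k : ZMod (2 ^ n)) = l) : S.ζ ^ k = S.ζ ^ l := by
  apply S.ι.injective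
  rw [map_pow, map_pow, S.ι_ζ]
  exact pow_eq_pow_of_modEq ((ZMod.natCast_eq_natCast_iff _ _ _).mp h) (alpha_pow n)

theorem ι_one_add (k : ℕ) : S.ι (1 + S.ζ ^ k + (S.ζ ^ k)⁻¹) = d n k := by
  simp [S.ι_ζ, d]

/-- The unit `1 + ζ ^ k + ζ ^ (-k)`. -/
def δ (k : ℕ) : S.Kˣ := Units.mk0 (1 + S.ζ ^ k + (S.ζ ^ k)⁻¹) fun h => d_ne_zero n k <| by
  rw [← ι_one_add, h, map_zero]

theorem map_δ (k : ℕ) : Units.map S.ι.toMonoidHom (S.δ k) = dUnit n k :=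
  Units.ext (S.ι_one_add k)

/-- The automorphism `α ↦ α ^ 5` as an endomorphism of the additively written unit group. -/
def φ : Module.End ℤ (Additive S.Kˣ) :=
  (MonoidHom.toAdditive (Units.map S.σ.toMonoidHom)).toIntLinearMap

theorem δ_eq_of_cast_eq {k l : ℕ} (h : (k : ZMod (2 ^ n)) = l) : S.δ k = S.δ l := by
  apply Units.ext
  simp [δ, S.ζ_pow_eq_of_cast_eq h]

theorem φ_δ (k : ℕ) : S.φ (Additive.ofMul (S.δ k)) = Additive.ofMul (S.δ (5 * k)) := by
  apply congrArg Additive.ofMul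
  apply Units.ext
  change S.σ (1 + S.ζ ^ k + (S.ζ ^ k)⁻¹) = 1 + S.ζ ^ (5 * k) + (S.ζ ^ (5 * k))⁻¹
  simp [S.σ_ζ, pow_mul]

theorem φ_pow_δ (i k : ℕ) :
    (S.φ ^ i) (Additive.ofMul (S.δ k)) = Additive.ofMul (S.δ (5 ^ i * k)) := by
  induction i with
  | zero => simp
  | succ i ih => rw [pow_succ', Module.End.mul_apply, ih, φ_δ, pow_succ', mul_assoc]

end GaloisModel

theorem cast_two_pow_mul_odd {n c : ℕ} (hc : Odd c) :
    ((2 ^ n * c : ℕ) : ZMod (2 ^ (n + 1))) = (2 ^ n : ℕ) := by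
  obtain ⟨b, rfl⟩ := hc
  rw [ZMod.natCast_eq_natCast_iff]
  have : 2 ^ n * (2 * b + 1) = 2 ^ (n + 1) * b + 2 ^ n := by ring
  rw [this]
  exact (Nat.modEq_zero_iff_dvd.mpr (dvd_mul_right _ _)).add_right _ |>.trans (by simp; rfl)

/-- σ^(2^i) shifts the exponent 2^s by half the period, so it negates ζ^(2^s); its square fixes
ζ^(2^s). -/
theorem five_pow_mul_two_pow_cast (s i : ℕ) :
    ((5 ^ 2 ^ i * 2 ^ s : ℕ) : ZMod (2 ^ (s + i + 3))) = (2 ^ s + 2 ^ (s + i + 2) : ℕ) := by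
  obtain ⟨c, hc, h⟩ := five_pow_two_pow i
  have h1 : 5 ^ 2 ^ i * 2 ^ s = 2 ^ s + 2 ^ (s + i + 2) * c := by rw [h]; ring
  rw [h1, Nat.cast_add, cast_two_pow_mul_odd hc, ← Nat.cast_add]

theorem five_pow_mul_two_pow_cast' (s i : ℕ) :
    ((5 ^ 2 ^ (i + 1) * 2 ^ s : ℕ) : ZMod (2 ^ (s + i + 3))) = (2 ^ s : ℕ) := by
  obtain ⟨c, hc, h⟩ := five_pow_two_pow (i + 1)
  have h1 : 5 ^ 2 ^ (i + 1) * 2 ^ s = 2 ^ s + 2 ^ (s + i + 3) * c := by rw [h]; ring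
  rw [h1, Nat.cast_add, Nat.cast_mul _ c, ZMod.natCast_self, zero_mul, add_zero]

namespace GaloisModel

variable {m : ℕ} (S : GaloisModel (m + 3))

theorem ζ_pow_two_pow : S.ζ ^ 2 ^ (m + 2) = -1 := by
  apply S.ι.injective
  rw [map_pow, S.ι_ζ, alpha_pow_two_pow_pred, map_neg, map_one]

theorem ζ_ne_zero : S.ζ ≠ 0 := by
  intro h
  apply alpha_ne_zero (m + 3)
  rw [← S.ι_ζ, h, map_zero]

theorem δ_add_coe (k : ℕ) :
    (S.δ (k + 2 ^ (m + 2)) : S.K) = 1 - S.ζ ^ k - (S.ζ ^ k)⁻¹ := by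
  simp only [δ, Units.val_mk0, pow_add S.ζ k, S.ζ_pow_two_pow, mul_neg, mul_one, inv_neg]
  ring

/-- With t = ζ^k + ζ^(-k), the product is (1 + t)(1 - t) = -δ(2k); squaring removes the sign. -/
theorem δ_mul_δ_add_sq (k : ℕ) : (S.δ k * S.δ (k + 2 ^ (m + 2))) ^ 2 = S.δ (2 * k) ^ 2 := by
  apply Units.ext
  have h : S.ζ ^ k ≠ 0 := pow_ne_zero _ S.ζ_ne_zero
  simp only [Units.val_pow_eq_pow_val, Units.val_mul, δ_add_coe]
  simp only [δ, Units.val_mk0, two_mul, pow_add]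
  generalize S.ζ ^ k = y at h
  field_simp
  ring

/-- Both units are real in ℂ, so equal powers give (1 - t)² = (1 + t)², hence t = 0. Then α^(2^s)
squares to -1, against the order of α. -/
theorem eq_of_δ_pow_eq {s c : ℕ} (hs : s ≤ m) (hc : c ≠ 0)
    (h : S.δ (2 ^ s + 2 ^ (m + 2)) ^ c = S.δ (2 ^ s) ^ c) : False := by
  obtain ⟨x, hx⟩ := exists_real_eq_d (m + 3) (2 ^ s + 2 ^ (m + 2))
  obtain ⟨y, hy⟩ := exists_real_eq_d (m + 3) (2 ^ s)
  have h1 : x ^ c = y ^ c := by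
    have := congrArg (Units.map S.ι.toMonoidHom) h
    rw [map_pow, map_pow, map_δ, map_δ, Units.ext_iff] at this
    simp only [Units.val_pow_eq_pow_val, dUnit, Units.val_mk0, ← hx, ← hy] at this
    exact_mod_cast this
  have h2 : |x| = |y| := by
    apply (pow_left_inj₀ (abs_nonneg x) (abs_nonneg y) hc).mp
    rw [← abs_pow, ← abs_pow, h1]
  have h3 : d (m + 3) (2 ^ s + 2 ^ (m + 2) : ℕ) ^ 2 = d (m + 3) (2 ^ s : ℕ) ^ 2 := by
    rw [← hx, ← hy]
    exact_mod_cast sq_eq_sq_iff_abs_eq_abs _ _ |>.mpr h2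
  simp only [d, zpow_neg, zpow_natCast, pow_add (alpha (m + 3)), alpha_pow_two_pow_pred (n := m + 2)] at h3
  have hne : alpha (m + 3) ^ 2 ^ s ≠ 0 := pow_ne_zero _ (alpha_ne_zero _)
  have h4 : (alpha (m + 3) ^ 2 ^ s) ^ 2 = -1 := by
    generalize alpha (m + 3) ^ 2 ^ s = y at h3 hne
    field_simp at h3
    have : (4 * y) * (y ^ 2 + 1) = 0 := by linear_combination -h3
    rcases mul_eq_zero.mp this with h | h
    · simp [hne] at h
    · linear_combination h
  rw [← pow_mul, ← pow_succ] at h4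
  have h5 : alpha (m + 3) ^ 2 ^ (s + 2) = 1 := by
    rw [pow_succ 2, pow_mul, h4]; norm_num
  have := (isPrimitiveRoot_alpha (m + 3)).dvd_of_pow_eq_one _ h5
  have := (Nat.pow_dvd_pow_iff_le_right (by norm_num)).mp this
  omega

/-- Up to sign, the units `1 + α ^ (2 ^ s) + α ^ (-2 ^ s)` are norms of `d_1`. -/
theorem exists_aeval_φ_δ {s : ℕ} (hs : s ≤ m + 1) : ∃ h : ℤ[X],
    2 • aeval S.φ h (Additive.ofMul (S.δ 1)) = 2 • Additive.ofMul (S.δ (2 ^ s)) := by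
  induction s with
  | zero => exact ⟨1, by simp⟩
  | succ s ih =>
    obtain ⟨h, hh⟩ := ih (by omega)
    obtain ⟨i, rfl⟩ := Nat.exists_eq_add_of_le (show s ≤ m by omega)
    -- Since s + i = m, the new factor multiplies δ(2^s) by its conjugate δ(2^s + 2^(m+2)), giving
    -- -δ(2^(s+1)).
    refine ⟨(1 + X ^ 2 ^ i) * h, ?_⟩
    rw [map_mul, Module.End.mul_apply, ← map_nsmul, hh, map_nsmul]
    simp only [map_add, map_one, map_pow, aeval_X, LinearMap.add_apply, Module.End.one_apply,
      φ_pow_δ]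
    rw [S.δ_eq_of_cast_eq (five_pow_mul_two_pow_cast s i)]
    have := congrArg Additive.ofMul (S.δ_mul_δ_add_sq (2 ^ s))
    rw [pow_succ' 2 s]
    simpa using this

theorem one_add_X_two_pow_dvd {f : ℤ[X]} (hf : aeval S.φ f (Additive.ofMul (S.δ 1)) = 0)
    {i : ℕ} (hi : i ≤ m) : (1 + X ^ 2 ^ i : ℚ[X]) ∣ f.map (Int.castRingHom ℚ) := by
  by_contra hnd
  have hmap : (1 + X ^ 2 ^ i : ℤ[X]).map (Int.castRingHom ℚ) = 1 + X ^ 2 ^ i := by simp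
  have hirr : Irreducible (1 + X ^ 2 ^ i : ℚ[X]) := by
    rw [← cyclotomic_two_pow_succ]
    exact cyclotomic.irreducible_rat (by positivity)
  rw [← hmap] at hnd hirr
  obtain ⟨c, hc, u, v, huv⟩ := exists_int_combination_eq_C hirr hnd
  obtain ⟨s, rfl⟩ := Nat.exists_eq_add_of_le' hi
  obtain ⟨h, hh⟩ := S.exists_aeval_φ_δ (show s ≤ s + i + 1 by omega)
  set x := Additive.ofMul (S.δ 1)
  -- Multiply u f + v (1 + X^(2^i)) = c by X^(2^i) - 1: the first term vanishes by `hf`, the second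
  -- because σ^(2^(i+1)) fixes δ(2^s).
  have e1 : aeval S.φ (C c * (X ^ 2 ^ i - 1) * h) x
      = aeval S.φ (u * (X ^ 2 ^ i - 1) * h) (aeval S.φ f x) +
        aeval S.φ (v * (X ^ 2 ^ (i + 1) - 1)) (aeval S.φ h x) := by
    simp only [← Module.End.mul_apply, ← map_mul, ← LinearMap.add_apply, ← map_add]
    rw [← huv]
    congr 2
    ring
  have e2 : 2 • aeval S.φ (C c * (X ^ 2 ^ i - 1) * h) x = 0 := by
    rw [e1, hf, map_zero, zero_add, ← map_nsmul, hh, map_nsmul, map_mul, Module.End.mul_apply]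
    simp only [map_sub, map_one, map_pow, aeval_X, LinearMap.sub_apply, Module.End.one_apply,
      φ_pow_δ]
    rw [S.δ_eq_of_cast_eq (five_pow_mul_two_pow_cast' s i), sub_self, nsmul_zero]
  rw [map_mul, Module.End.mul_apply, ← map_nsmul, hh, map_nsmul, map_mul, Module.End.mul_apply]
    at e2
  simp only [map_sub, map_one, map_pow, aeval_X, LinearMap.sub_apply, Module.End.one_apply,
    φ_pow_δ] at e2
  rw [S.δ_eq_of_cast_eq (five_pow_mul_two_pow_cast s i), aeval_C] at e2
  simp only [algebraMap_int_eq, eq_intCast, Module.End.intCast_apply] at e2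
  have hc2 : (2 * c).natAbs ≠ 0 := by simpa using hc
  apply S.eq_of_δ_pow_eq (s := s) (by omega) hc2
  have e3 : S.δ (2 ^ s + 2 ^ (s + i + 2)) ^ (2 * c) =
      S.δ (2 ^ s) ^ (2 * c) :=
    Additive.ofMul.injective (by
      rw [ofMul_zpow, ofMul_zpow]
      linear_combination (norm := module) e2)
  rcases Int.natAbs_eq (2 * c) with h | h
  · rw [h] at e3; simpa only [zpow_natCast] using e3
  · rw [h] at e3; simpa only [zpow_neg, zpow_natCast, inv_inj] using e3

end GaloisModel

end CircularUnits

/-! ### Independence of the generators and the index. -/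

namespace CircularUnits

namespace GaloisModel

variable {n : ℕ} (S : GaloisModel n)

theorem δ_eq_of_cast_eq_neg {k l : ℕ} (h : (k : ZMod (2 ^ n)) = -l) : S.δ k = S.δ l := by
  have hkl : S.ζ ^ k * S.ζ ^ l = 1 := by
    rw [← pow_add, ← pow_zero S.ζ]
    apply S.ζ_pow_eq_of_cast_eq
    rw [Nat.cast_add, h, neg_add_cancel, Nat.cast_zero]
  have hk := eq_inv_of_mul_eq_one_left hkl
  apply Units.ext
  simp only [δ, Units.val_mk0, hk, inv_inv]
  ring

end GaloisModel

/-- The generators of `D` are multiplicatively independent. -/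
theorem linearIndependent_dUnit (m : ℕ) : LinearIndependent ℤ
    fun l : Fin (2 ^ (m + 1) - 1) => Additive.ofMul (dUnit (m + 3) (2 * (l : ℕ) + 1)) := by
  obtain ⟨S⟩ := nonempty_galoisModel (m + 3)
  obtain ⟨e, he, hinj, h5⟩ := exists_five_pow_index (m + 1)
  have hδ : ∀ l < 2 ^ (m + 1), S.δ (2 * l + 1) = S.δ (5 ^ e l) := by
    intro l hl
    rcases h5 l hl with h | h
    · exact S.δ_eq_of_cast_eq (by exact_mod_cast h)
    · exact S.δ_eq_of_cast_eq_neg (by exact_mod_cast h)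
  rw [Fintype.linearIndependent_iff]
  intro g hg l₀
  have hlt : ∀ l : Fin (2 ^ (m + 1) - 1), (l : ℕ) < 2 ^ (m + 1) := fun l => by omega
  have hpos : 0 < 2 ^ (m + 1) := by positivity
  let f : ℤ[X] := ∑ l : Fin (2 ^ (m + 1) - 1), C (g l) * X ^ e l
  have hf : aeval S.φ f (Additive.ofMul (S.δ 1)) = 0 := by
    have hι : Function.Injective (MonoidHom.toAdditive (Units.map S.ι.toMonoidHom)) :=
      Units.map_injective S.ι.injective
    apply hι
    rw [map_zero, ← hg, map_sum, LinearMap.sum_apply, map_sum]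
    refine Finset.sum_congr rfl fun l _ => ?_
    rw [map_mul, Module.End.mul_apply, map_pow, aeval_X, aeval_C, S.φ_pow_δ, mul_one,
      ← hδ l (hlt l), algebraMap_int_eq, eq_intCast, Module.End.intCast_apply, map_zsmul]
    congr 1
    have := S.map_δ (2 * l + 1)
    exact congrArg Additive.ofMul (by simpa using this)
  have hcoeff : ∀ k, f.coeff k = ∑ l : Fin (2 ^ (m + 1) - 1), if k = e l then g l else 0 := by
    intro k
    simp [f, finsetSum_coeff, coeff_X_pow]
  have hf0 : f.map (Int.castRingHom ℚ) = 0 := by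
    -- This `k` is the exponent of the one conjugate left out of the generators, d_{2^(n-1) - 1}.
    refine eq_zero_of_forall_one_add_X_two_pow_dvd (m := m + 1) (k := e (2 ^ (m + 1) - 1)) ?_
      (he _ (by omega)) ?_ fun i hi => S.one_add_X_two_pow_dvd hf (by omega)
    · rw [degree_lt_iff_coeff_zero]
      intro k hk
      rw [coeff_map, hcoeff, Finset.sum_eq_zero, map_zero]
      intro l _
      have := he l (hlt l)
      rw [if_neg (by omega)]
    · rw [coeff_map, hcoeff, Finset.sum_eq_zero, map_zero]
      intro l _
      rw [if_neg]
      intro h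
      have := hinj (show 2 ^ (m + 1) - 1 < 2 ^ (m + 1) by omega) (hlt l) h
      omega
  have hf1 : f = 0 := map_injective _ Int.cast_injective (by rw [hf0, Polynomial.map_zero])
  have := hcoeff (e l₀)
  rw [hf1, coeff_zero, Finset.sum_eq_single l₀, if_pos rfl] at this
  · exact this.symm
  · intro l _ hl
    rw [if_neg]
    intro h
    exact hl (Fin.ext (hinj (hlt l₀) (hlt l) h).symm)
  · simp

theorem toIntSubmodule_D (m : ℕ) : (Subgroup.toAddSubgroup (D (m + 3))).toIntSubmodule =
    Submodule.span ℤ (Set.range fun l : Fin (2 ^ (m + 1) - 1) =>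
      Additive.ofMul (dUnit (m + 3) (2 * (l : ℕ) + 1))) := by
  apply Submodule.toAddSubgroup_injective
  rw [Submodule.span_int_eq_addSubgroupClosure, D, Subgroup.toAddSubgroup_closure]
  change AddSubgroup.closure _ = _
  congr 1
  ext u
  constructor
  · rintro ⟨l, hl, hu⟩
    exact ⟨⟨l, hl⟩, hu.symm⟩
  · rintro ⟨l, hu⟩
    exact ⟨l, l.2, hu.symm⟩

theorem relIndex_DPow (m : ℕ) : (DPow (m + 3)).relIndex (D (m + 3)) =
    (2 ^ (m + 1)) ^ (2 ^ (m + 1) - 1) := by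
  have hli := linearIndependent_dUnit m
  have hS := toIntSubmodule_D m
  have : Module.Free ℤ (Subgroup.toAddSubgroup (D (m + 3))).toIntSubmodule := by
    rw [hS]; exact Module.Free.of_basis (Module.Basis.span hli)
  have : Module.Finite ℤ (Subgroup.toAddSubgroup (D (m + 3))).toIntSubmodule := by
    rw [hS]; exact Module.Finite.of_basis (Module.Basis.span hli)
  have hr : Module.finrank ℤ (Subgroup.toAddSubgroup (D (m + 3))).toIntSubmodule =
      2 ^ (m + 1) - 1 := by
    rw [hS, finrank_span_eq_card hli, Fintype.card_fin]
  have := AddSubgroup.relIndex_map_nsmul (2 ^ (m + 1)) (Subgroup.toAddSubgroup (D (m + 3)))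
  rw [← Subgroup.relIndex_toAddSubgroup]
  exact this.trans (congrArg _ hr)

/-! ### Integrality and the congruence modulo 2. -/

theorem alpha_zpow_mem_intRing (n : ℕ) (j : ℤ) : alpha n ^ j ∈ intRing n := by
  have h : alpha n ∈ intRing n := Algebra.subset_adjoin rfl
  have hinv : (alpha n)⁻¹ ∈ intRing n := by
    rw [inv_eq_of_mul_eq_one_right (b := alpha n ^ (2 ^ n - 1))]
    · exact pow_mem h _
    · rw [← pow_succ', Nat.sub_add_cancel Nat.one_le_two_pow, alpha_pow]
  cases j with
  | ofNat k => simpa using pow_mem h k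
  | negSucc k => simpa [zpow_negSucc] using pow_mem hinv (k + 1)

theorem alpha_zpow_odd_pow {n : ℕ} {j : ℤ} (hj : Odd j) : (alpha (n + 1) ^ j) ^ 2 ^ n = -1 := by
  rw [← zpow_natCast, zpow_comm, zpow_natCast, alpha_pow_two_pow_pred, hj.neg_one_zpow]

theorem d_mem_intRing (n : ℕ) (j : ℤ) : d n j ∈ intRing n :=
  add_mem (add_mem (one_mem _) (alpha_zpow_mem_intRing n j)) (alpha_zpow_mem_intRing n (-j))

/-- For b = α^j, d_j = (b³ - 1) / (b (b - 1)). As 3 is invertible modulo the order, b is a power of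
b³, so b³ - 1 divides b - 1. This makes `E` closed under inverses. -/
theorem inv_d_mem_intRing {n : ℕ} {j : ℤ} (hj : Odd j) : (d (n + 1) j)⁻¹ ∈ intRing (n + 1) := by
  have hmem := alpha_zpow_mem_intRing (n + 1) j
  have h1 : alpha (n + 1) ^ j ≠ 1 := by
    intro h
    have := alpha_zpow_odd_pow (n := n) hj
    rw [h, one_pow] at this
    norm_num at this
  have h0 : alpha (n + 1) ^ j ≠ 0 := zpow_ne_zero _ (alpha_ne_zero _)
  have hN : (alpha (n + 1) ^ j) ^ 2 ^ (n + 1) = 1 := by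
    rw [← zpow_natCast, zpow_comm, zpow_natCast, alpha_pow, one_zpow]
  have hd : d (n + 1) j = 1 + alpha (n + 1) ^ j + (alpha (n + 1) ^ j)⁻¹ := by rw [d, zpow_neg]
  rw [hd]
  generalize alpha (n + 1) ^ j = b at *
  have h3 : Nat.Coprime 3 (2 ^ (n + 1)) := Nat.Coprime.pow_right _ (by norm_num)
  obtain ⟨t, ht⟩ := Nat.exists_mul_mod_eq_one_of_coprime h3 (Nat.one_lt_two_pow (by omega))
  have hb : (b ^ 3) ^ t = b := by
    rw [← pow_mul]
    conv_rhs => rw [← pow_one b]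
    refine pow_eq_pow_of_modEq ?_ hN
    exact ht.2.trans (Nat.mod_eq_of_lt (Nat.one_lt_two_pow (by omega))).symm
  have hgeom := geom_sum_mul (b ^ 3) t
  rw [hb] at hgeom
  rw [inv_eq_of_mul_eq_one_right (b := (∑ i ∈ Finset.range t, (b ^ 3) ^ i) * b)]
  · exact mul_mem (sum_mem fun i _ => pow_mem (pow_mem hmem 3) i) hmem
  · have h2 := sub_ne_zero.mpr h1
    apply mul_right_cancel₀ h2
    generalize (∑ i ∈ Finset.range t, (b ^ 3) ^ i) = s at *
    linear_combination hgeom + s * (b - 1) * inv_mul_cancel₀ h0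

theorem D_le_units_intRing (n : ℕ) :
    D (n + 1) ≤ (intRing (n + 1)).toSubsemiring.toSubmonoid.units := by
  rw [D, Subgroup.closure_le]
  rintro _ ⟨l, -, rfl⟩
  rw [SetLike.mem_coe, Submonoid.mem_units_iff, Units.val_inv_eq_inv_val]
  exact ⟨d_mem_intRing _ _, inv_d_mem_intRing (odd_two_mul_add_one _)⟩

/-- The set `E` as a subgroup. -/
def congruenceSubgroup (n : ℕ) : Subgroup ℂˣ where
  carrier := E (n + 1)
  one_mem' := ⟨one_mem _, 0, zero_mem _, by simp⟩
  mul_mem' := by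
    rintro a b ⟨ha, ρ, hρ, h⟩ ⟨hb, τ, hτ, h'⟩
    refine ⟨mul_mem ha hb, ρ + τ + 2 * (ρ * τ), ?_, ?_⟩
    · exact add_mem (add_mem hρ hτ) (mul_mem (ofNat_mem _ 2) (mul_mem hρ hτ))
    · rw [Units.val_mul, h, h']; ring
  inv_mem' := by
    rintro a ⟨ha, ρ, hρ, h⟩
    have hinv : ((a⁻¹ : ℂˣ) : ℂ) ∈ intRing (n + 1) :=
      (Submonoid.mem_units_iff _ _).mp (D_le_units_intRing n ha) |>.2
    refine ⟨inv_mem ha, -(ρ * (a⁻¹ : ℂˣ)), neg_mem (mul_mem hρ hinv), ?_⟩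
    have := a.mul_inv
    rw [h] at this
    linear_combination this

theorem exists_one_add_add_pow_two_pow {R : Type*} [CommRing R] {A : Subring R} {a b : R}
    (ha : a ∈ A) (hb : b ∈ A) (k : ℕ) :
    ∃ ρ ∈ A, (1 + a + b) ^ 2 ^ k = 1 + a ^ 2 ^ k + b ^ 2 ^ k + 2 * ρ := by
  induction k with
  | zero => exact ⟨0, zero_mem _, by simp⟩
  | succ k ih =>
    obtain ⟨ρ, hρ, h⟩ := ih
    have ha' := pow_mem ha (2 ^ k)
    have hb' := pow_mem hb (2 ^ k)
    have h1 := add_mem (add_mem (one_mem A) ha') hb'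
    refine ⟨a ^ 2 ^ k + b ^ 2 ^ k + a ^ 2 ^ k * b ^ 2 ^ k +
      2 * (ρ * (1 + a ^ 2 ^ k + b ^ 2 ^ k)) + 2 * (ρ * ρ), ?_, ?_⟩
    · exact add_mem (add_mem (add_mem (add_mem ha' hb') (mul_mem ha' hb'))
        (mul_mem (ofNat_mem _ 2) (mul_mem hρ h1))) (mul_mem (ofNat_mem _ 2) (mul_mem hρ hρ))
    · rw [pow_succ, pow_mul, h, pow_mul, pow_mul]; ring

theorem DPow_le_D (n : ℕ) : DPow n ≤ D n := by
  rintro _ ⟨u, hu, rfl⟩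
  exact pow_mem hu _

theorem DPow_le_congruenceSubgroup (m : ℕ) : DPow (m + 3) ≤ congruenceSubgroup (m + 2) := by
  rw [DPow, D, MonoidHom.map_closure, Subgroup.closure_le]
  rintro _ ⟨_, ⟨l, hl, rfl⟩, rfl⟩
  have hD : dUnit (m + 3) (2 * (l : ℤ) + 1) ∈ D (m + 3) := Subgroup.subset_closure ⟨l, hl, rfl⟩
  refine ⟨pow_mem hD _, ?_⟩
  set j : ℤ := 2 * (l : ℤ) + 1
  obtain ⟨ρ, hρ, h⟩ := exists_one_add_add_pow_two_pow (A := (intRing (m + 3)).toSubring)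
    (alpha_zpow_mem_intRing (m + 3) j) (alpha_zpow_mem_intRing (m + 3) (-j)) (m + 1)
  refine ⟨ρ, hρ, ?_⟩
  -- Hence this power and its inverse cancel in the sum.
  have hsq : ((alpha (m + 3) ^ j) ^ 2 ^ (m + 1)) ^ 2 = -1 := by
    rw [← pow_mul, ← pow_succ]
    exact alpha_zpow_odd_pow (odd_two_mul_add_one _)
  have hne : (alpha (m + 3) ^ j) ^ 2 ^ (m + 1) ≠ 0 :=
    pow_ne_zero _ (zpow_ne_zero _ (alpha_ne_zero _))
  change d (m + 3) j ^ 2 ^ (m + 1) = _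
  rw [d, h, zpow_neg, inv_pow]
  generalize (alpha (m + 3) ^ j) ^ 2 ^ (m + 1) = y at hsq hne
  field_simp
  linear_combination hsq

/-- Membership would put α (d_1 - 1) = α² + 1 in 2ℤ[α]; reduction modulo 2 gives a contradiction of
degrees. -/
theorem dUnit_one_notMem_congruenceSubgroup (m : ℕ) :
    dUnit (m + 3) 1 ∉ congruenceSubgroup (m + 2) := by
  rintro ⟨-, ρ, hρ, h⟩
  have hα : alpha (m + 3) ∈ intRing (m + 3) := Algebra.subset_adjoin rfl
  obtain ⟨P, hP⟩ : ∃ P : ℤ[X], aeval (alpha (m + 3)) P = ρ * alpha (m + 3) := by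
    have := mul_mem hρ hα
    rwa [intRing, Algebra.adjoin_singleton_eq_range_aeval] at this
  have hroot : aeval (alpha (m + 3)) (X ^ 2 + 1 - C 2 * P) = 0 := by
    have h0 := alpha_ne_zero (m + 3)
    change d (m + 3) 1 = _ at h
    rw [d, zpow_neg, zpow_one] at h
    field_simp at h
    simp only [map_sub, map_add, map_mul, map_pow, aeval_X, map_one, hP, aeval_C]
    simp only [algebraMap_int_eq, eq_intCast, Int.cast_ofNat]
    linear_combination h
  have hprim := isPrimitiveRoot_alpha (m + 3)
  have hdvd := minpoly.isIntegrallyClosed_dvd (hprim.isIntegral (by positivity)) hroot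
  rw [← cyclotomic_eq_minpoly hprim (by positivity)] at hdvd
  have hdvd2 := Polynomial.map_dvd (Int.castRingHom (ZMod 2)) hdvd
  have h2 : (Int.castRingHom (ZMod 2)) 2 = 0 := by decide
  rw [map_cyclotomic, Polynomial.map_sub, Polynomial.map_mul, map_C, h2, C_0, zero_mul, sub_zero,
    Polynomial.map_add, Polynomial.map_pow, map_X, Polynomial.map_one] at hdvd2
  have hdeg : (X ^ 2 + 1 : (ZMod 2)[X]).natDegree = 2 := by compute_degree!
  have hle := natDegree_le_of_dvd hdvd2 (ne_zero_of_natDegree_gt (n := 0) (by rw [hdeg]; norm_num))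
  rw [hdeg, natDegree_cyclotomic, Nat.totient_prime_pow_succ Nat.prime_two] at hle
  have : 1 ≤ 2 ^ m := Nat.one_le_two_pow
  rw [pow_succ, pow_succ] at hle
  omega

end CircularUnits

end

theorem propositionp (n : ℕ) (hn : 3 ≤ n) :
    (CircularUnits.DPow n ≤ CircularUnits.D n ∧
      (CircularUnits.DPow n).relIndex (CircularUnits.D n) =
        (2 ^ (n - 2)) ^ (2 ^ (n - 2) - 1) ∧
      (CircularUnits.DPow n).relIndex (CircularUnits.D n) =
        2 ^ ((n - 2) * (2 ^ (n - 2) - 1)) ∧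
      Nat.card (CircularUnits.D n ⧸
          (CircularUnits.DPow n).subgroupOf (CircularUnits.D n)) =
        2 ^ ((n - 2) * (2 ^ (n - 2) - 1))) ∧
    ∃ H : Subgroup ℂˣ, (H : Set ℂˣ) = CircularUnits.E n ∧
      CircularUnits.DPow n ≤ H ∧ H < CircularUnits.D n := by
  obtain ⟨m, rfl⟩ := Nat.exists_eq_add_of_le' hn
  have hi := CircularUnits.relIndex_DPow m
  have hi' : (CircularUnits.DPow (m + 3)).relIndex (CircularUnits.D (m + 3)) =
      2 ^ ((m + 1) * (2 ^ (m + 1) - 1)) := by rw [hi, ← pow_mul]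
  refine ⟨⟨CircularUnits.DPow_le_D _, hi, hi', hi'⟩, CircularUnits.congruenceSubgroup (m + 2), rfl,
    CircularUnits.DPow_le_congruenceSubgroup m, lt_of_le_of_ne (fun u hu => hu.1) fun h => ?_⟩
  apply CircularUnits.dUnit_one_notMem_congruenceSubgroup m
  rw [h]
  refine Subgroup.subset_closure ⟨0, ?_, by simp⟩
  have : 2 ≤ 2 ^ (m + 3 - 2) := Nat.le_self_pow (by omega) 2
  omega
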